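/- Let $G$ be a finite simple graph with at least two vertices and let $u$ be a vertex of $G$ such that at least one of the following holds: (1) $u$ is universal (adjacent to all other vertices); (2) $u$ has degree $1$; (3) the neighbourhood $N(u)$ is a minimal separator of $G-u$, that is, there are two vertices $a,b$ of $G-u$ such that $N(u)$ is inclusion-minimal among the sets $S\subseteq V(G-u)\setminus\{a,b\}$ for which every path from $a$ to $b$ in $G-u$ meets $S$; (4) $N(u)$ is an inclusion-maximal clique of $G-u$. Then $G$ is a leaf power if and only if $G-u$ is a leaf power. Here a graph $H$ is a leaf power if there are a finite tree $T$ whose set of leaves is $V(H)$ (up to a bijection) and a rational edge-weight function $\mathsf{w}:E(T)\to[0,1]$ such that distinct vertices $x,y$ of $H$ are adjacent if and only if $d_T(x,y)\le 1$, where $d_T(x,y)$ is the sum of the weights on the path of $T$ between $x$ and $y$. The node of a one-node tree counts as a leaf. -/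

import Mathlib

namespace LeafPower

/-- The distance `d_T(x, y)` in an edge-weighted tree: the sum of the weights of the edges of the
unique path from `x` to `y`. Only the values of `w` on edges of `T` matter. -/
noncomputable def treeDist {N : Type*} {T : SimpleGraph N} (hT : T.IsTree) (w : Sym2 N → ℚ)
    (x y : N) : ℚ :=
  ((hT.existsUnique_path x y).choose.edges.map w).sum

/-- A leaf of a tree: a node of degree at most one. In a tree with at least two nodes this means
degree exactly one; the node of a one-node tree counts as a leaf. -/
def IsLeaf {N : Type*} (T : SimpleGraph N) (x : N) : Prop :=
  (T.neighborSet x).encard ≤ 1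

/-- `(T, w)` is a leaf root of `G`: `T` is a tree with rational edge weights in `[0, 1]`, the
vertices of `G` are, through the bijection `leaf`, exactly the leaves of `T`, and two
distinct vertices of `G` are adjacent iff their distance in `T` is at most one. -/
structure IsLeafRoot {V N : Type*} (G : SimpleGraph V) (T : SimpleGraph N) (w : Sym2 N → ℚ)
    (leaf : V → N) : Prop where
  isTree : T.IsTree
  weight_mem : ∀ e ∈ T.edgeSet, w e ∈ Set.Icc (0 : ℚ) 1
  leaf_injective : Function.Injective leaf
  range_leaf : Set.range leaf = {x | IsLeaf T x}
  adj_iff : ∀ u v : V, u ≠ v → (G.Adj u v ↔ treeDist isTree w (leaf u) (leaf v) ≤ 1)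

/-- A leaf power is a graph that admits a leaf root (with a finite tree). -/
def IsLeafPower {V : Type*} (G : SimpleGraph V) : Prop :=
  ∃ (N : Type) (_ : Finite N) (T : SimpleGraph N) (w : Sym2 N → ℚ) (leaf : V → N),
    IsLeafRoot G T w leaf

/-- `S` separates `a` from `b` in `G`: neither lies in `S`, and every walk from `a` to `b`
meets `S`. -/
def Separates {V : Type*} (G : SimpleGraph V) (S : Set V) (a b : V) : Prop :=
  a ∉ S ∧ b ∉ S ∧ ∀ p : G.Walk a b, ∃ s ∈ p.support, s ∈ S

/-- `S` is a minimal separator of `G`: for some vertices `a`, `b` it is inclusion-minimal among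
the vertex sets that separate `a` from `b`. -/
def IsMinimalSeparator {V : Type*} (G : SimpleGraph V) (S : Set V) : Prop :=
  ∃ a b : V, Minimal (fun X : Set V => Separates G X a b) S

/-- The graph `G - u`, induced on the vertices other than `u`. -/
abbrev deleteVertex {V : Type*} (G : SimpleGraph V) (u : V) :
    SimpleGraph ({u}ᶜ : Set V) :=
  G.induce ({u}ᶜ : Set V)

/-- The neighbourhood `N(u)` of `u` in `G`, as a set of vertices of `G - u`. -/
def nbhd {V : Type*} (G : SimpleGraph V) (u : V) : Set ({u}ᶜ : Set V) :=
  {v | G.Adj u v}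

end LeafPower

/-! Leaf powers are handled through Gromov products instead of trees. Seen from a base point, the
products `m x y` of leaves (the height at which the paths to `x` and `y` part) form a nonnegative
symmetric system with the ultrametric inequality, and distances are `m x x + m y y - 2 * m x y`.
Conversely, every such rational system on a finite nonempty vertex set is realized by a leaf root
(`IsGromovRep.isLeafPower`). Deleting a vertex is then a restriction.

For the other direction, `IsGromovRep.attach` hangs `u` on the tree at height `t` of the path to
some `b`, by an edge of length `r`; it remains to choose `b`, `t`, `r`. A universal vertex goes at
the base point after shrinking the tree, a vertex of degree one at its neighbour, and for a maximal
clique `u` goes at the midpoint of a diametral pair. For a minimal separator of `a` and `b`, balls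
of radius `1 / 2` around the vertices cut intervals out of the path from `a` to `b`. Those from the
component of `a` cover an initial segment and end strictly before those from the component of `b`
begin; just past that segment lies a point covered exactly by the separator. -/

namespace LeafPower

open SimpleGraph

/-! ### Medians and distances in weighted trees -/

section TreeMetric

variable {N : Type*} {T : SimpleGraph N}

/-- `c` lies on a path from `x` to `y`. -/
def OnPath (T : SimpleGraph N) (x c y : N) : Prop :=
  ∃ (p : T.Walk x c) (q : T.Walk c y), (p.append q).IsPath

theorem OnPath.of_mem_support {x y c : N} {p : T.Walk x y} (hp : p.IsPath) (hc : c ∈ p.support) :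
    OnPath T x c y := by
  obtain ⟨q, r, rfl⟩ := Walk.mem_support_iff_exists_append.1 hc
  exact ⟨q, r, hp⟩

theorem OnPath.symm {x y c : N} (h : OnPath T x c y) : OnPath T y c x := by
  obtain ⟨p, q, h⟩ := h
  exact ⟨q.reverse, p.reverse, by rw [← Walk.reverse_append]; exact h.reverse⟩

theorem OnPath.trans (hT : T.IsTree) {x y c d : N} (h : OnPath T x c d) (h' : OnPath T x d y) :
    OnPath T x c y := by
  obtain ⟨p, q, h⟩ := h
  obtain ⟨r, s, h'⟩ := h'
  have hr : r = p.append q := (hT.existsUnique_path x d).unique h'.of_append_left h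
  subst hr
  rw [← Walk.append_assoc] at h'
  exact ⟨_, _, h'⟩

theorem OnPath.total (hT : T.IsTree) {x y c d : N} (hc : OnPath T x c y) (hd : OnPath T x d y) :
    OnPath T x c d ∨ OnPath T x d c := by
  obtain ⟨p, q, h⟩ := hc
  obtain ⟨r, s, h'⟩ := hd
  have e : p.append q = r.append s := (hT.existsUnique_path x y).unique h h'
  have hm : c ∈ (r.append s).support := by
    rw [← e, Walk.mem_support_append_iff]; exact Or.inl p.end_mem_support
  rw [Walk.mem_support_append_iff] at hm
  rcases hm with hm | hm
  · exact Or.inl (OnPath.of_mem_support h'.of_append_left hm)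
  · obtain ⟨s₁, s₂, rfl⟩ := Walk.mem_support_iff_exists_append.1 hm
    rw [Walk.append_assoc] at h'
    exact Or.inr ⟨_, _, h'.of_append_left⟩

/-- A path that ends on a set of nodes has an initial segment that meets the set only in its last
node. -/
theorem exists_path_to_first_hit (S : Set N) {a z : N} (p : T.Walk a z) (hp : p.IsPath)
    (hz : z ∈ S) :
    ∃ c ∈ S, ∃ q : T.Walk a c, q.IsPath ∧ q.support ⊆ p.support ∧
      ∀ v ∈ q.support, v ∈ S → v = c := by
  induction p with
  | nil => exact ⟨_, hz, .nil, by simp, by simp, by simp⟩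
  | @cons a b z hab p ih =>
    by_cases ha : a ∈ S
    · exact ⟨a, ha, .nil, by simp, by simp, by simp⟩
    · rw [Walk.cons_isPath_iff] at hp
      obtain ⟨c, hc, q, hq, hqp, hqS⟩ := ih hp.1 hz
      refine ⟨c, hc, .cons hab q, ?_, ?_, ?_⟩
      · rw [Walk.cons_isPath_iff]
        exact ⟨hq, fun h => hp.2 (hqp h)⟩
      · simp only [Walk.support_cons]
        exact List.cons_subset_cons _ hqp
      · intro v hv hvS
        simp only [Walk.support_cons, List.mem_cons] at hv
        rcases hv with rfl | hv
        · exact absurd hvS ha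
        · exact hqS v hv hvS

theorem isPath_append_of_inter {a c x : N} {p : T.Walk a c} {q : T.Walk c x} (hp : p.IsPath)
    (hq : q.IsPath) (h : ∀ v ∈ p.support, v ∈ q.support → v = c) : (p.append q).IsPath := by
  rw [Walk.isPath_def, Walk.support_append, List.nodup_append']
  refine ⟨hp.support_nodup, hq.support_nodup.sublist (List.tail_sublist _), ?_⟩
  intro v hv hv'
  have hvc := h v hv (List.mem_of_mem_tail hv')
  subst hvc
  have := hq.support_nodup
  rw [← Walk.cons_tail_support, List.nodup_cons] at this
  exact this.1 hv'

/-- Any three nodes of a tree have a median. -/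
theorem exists_median (hT : T.IsTree) (a x y : N) :
    ∃ c, OnPath T a c x ∧ OnPath T a c y ∧ OnPath T x c y := by
  obtain ⟨q, hq, -⟩ := hT.existsUnique_path x y
  obtain ⟨p, hp, -⟩ := hT.existsUnique_path a x
  -- The median is the node where the path from `a` first meets the path from `x` to `y`.
  obtain ⟨c, hc, r, hr, -, h⟩ :=
    exists_path_to_first_hit {v | v ∈ q.support} p hp q.start_mem_support
  obtain ⟨q₁, q₂, rfl⟩ := Walk.mem_support_iff_exists_append.1 hc
  refine ⟨c, ⟨r, q₁.reverse, isPath_append_of_inter hr hq.of_append_left.reverse ?_⟩,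
    ⟨r, q₂, isPath_append_of_inter hr hq.of_append_right ?_⟩, ⟨q₁, q₂, hq⟩⟩
  · intro v hv hv'
    refine h v hv ?_
    simp only [Set.mem_ofPred_eq, Walk.mem_support_append_iff]
    exact Or.inl (by simpa using hv')
  · intro v hv hv'
    refine h v hv ?_
    simp only [Set.mem_ofPred_eq, Walk.mem_support_append_iff]
    exact Or.inr hv'

variable {w : Sym2 N → ℚ}

theorem treeDist_eq_of_isPath (hT : T.IsTree) (w : Sym2 N → ℚ) {x y : N} {p : T.Walk x y}
    (hp : p.IsPath) : treeDist hT w x y = (p.edges.map w).sum := by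
  have := (hT.existsUnique_path x y).unique (hT.existsUnique_path x y).choose_spec.1 hp
  rw [treeDist, this]

theorem treeDist_self (hT : T.IsTree) (x : N) : treeDist hT w x x = 0 := by
  rw [treeDist_eq_of_isPath hT w Walk.IsPath.nil]; simp

theorem treeDist_of_adj (hT : T.IsTree) {x y : N} (h : T.Adj x y) :
    treeDist hT w x y = w s(x, y) := by
  rw [treeDist_eq_of_isPath hT w (p := h.toWalk) (by simp [h.ne])]; simp

theorem treeDist_comm (hT : T.IsTree) (x y : N) : treeDist hT w x y = treeDist hT w y x := by
  obtain ⟨p, hp, -⟩ := hT.existsUnique_path x y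
  rw [treeDist_eq_of_isPath hT w hp, treeDist_eq_of_isPath hT w hp.reverse]
  simp [List.sum_reverse]

theorem treeDist_nonneg (hT : T.IsTree) (hw : ∀ e ∈ T.edgeSet, 0 ≤ w e) (x y : N) :
    0 ≤ treeDist hT w x y := by
  obtain ⟨p, hp, -⟩ := hT.existsUnique_path x y
  rw [treeDist_eq_of_isPath hT w hp]
  refine List.sum_nonneg fun r hr => ?_
  obtain ⟨e, he, rfl⟩ := List.mem_map.1 hr
  exact hw e (p.edges_subset_edgeSet he)

theorem OnPath.treeDist_add (hT : T.IsTree) {x c y : N} (h : OnPath T x c y) :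
    treeDist hT w x y = treeDist hT w x c + treeDist hT w c y := by
  obtain ⟨p, q, h⟩ := h
  rw [treeDist_eq_of_isPath hT w h, treeDist_eq_of_isPath hT w h.of_append_left,
    treeDist_eq_of_isPath hT w h.of_append_right]
  simp

theorem treeDist_triangle (hT : T.IsTree) (hw : ∀ e ∈ T.edgeSet, 0 ≤ w e) (x y z : N) :
    treeDist hT w x z ≤ treeDist hT w x y + treeDist hT w y z := by
  obtain ⟨c, h₁, h₂, h₃⟩ := exists_median hT y x z
  rw [treeDist_comm hT x y, h₁.treeDist_add hT, h₂.treeDist_add hT, h₃.treeDist_add hT,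
    treeDist_comm hT x c]
  linarith [treeDist_nonneg hT hw y c]

/-- A function that changes along each edge by at most its weight is `1`-Lipschitz. -/
theorem sub_le_treeDist (hT : T.IsTree) (f : N → ℚ)
    (hf : ∀ x y, T.Adj x y → f y - f x ≤ w s(x, y)) (x y : N) : f y - f x ≤ treeDist hT w x y := by
  obtain ⟨p, hp, -⟩ := hT.existsUnique_path x y
  rw [treeDist_eq_of_isPath hT w hp]
  clear hp
  induction p with
  | nil => simp
  | cons h p ih =>
    simp only [Walk.edges_cons, List.map_cons, List.sum_cons]
    linarith [hf _ _ h]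

/-- Gromov products in a tree satisfy the ultrametric inequality. -/
theorem min_gromov_le (hT : T.IsTree) (hw : ∀ e ∈ T.edgeSet, 0 ≤ w e) (a x y z : N) :
    min (treeDist hT w a x + treeDist hT w a y - treeDist hT w x y)
      (treeDist hT w a y + treeDist hT w a z - treeDist hT w y z) ≤
      treeDist hT w a x + treeDist hT w a z - treeDist hT w x z := by
  obtain ⟨c, hcx, hcy, hcxy⟩ := exists_median hT a x y
  obtain ⟨d, hdy, hdz, hdyz⟩ := exists_median hT a y z
  have key : ∀ e, OnPath T a e x → OnPath T a e z → 2 * treeDist hT w a e ≤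
      treeDist hT w a x + treeDist hT w a z - treeDist hT w x z := by
    intro e hx hz
    rw [hx.treeDist_add hT, hz.treeDist_add hT]
    linarith [treeDist_triangle hT hw x e z, treeDist_comm (w := w) hT x e]
  -- Both medians lie on the path from `a` to `y`; the one nearer to `a` also lies on the paths to
  -- `x` and `z`.
  rcases hcy.total hT hdy with h | h
  · refine (min_le_left _ _).trans (le_trans (le_of_eq ?_) (key c hcx (h.trans hT hdz)))
    rw [hcx.treeDist_add hT, hcy.treeDist_add hT, hcxy.treeDist_add hT, treeDist_comm hT x c]
    ring
  · refine (min_le_right _ _).trans (le_trans (le_of_eq ?_) (key d (h.trans hT hcx) hdz))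
    rw [hdy.treeDist_add hT, hdz.treeDist_add hT, hdyz.treeDist_add hT, treeDist_comm hT y d]
    ring

end TreeMetric

/-! ### Gromov products of leaf powers -/

/-- `m` is a system of Gromov products (with `m x x` the distance of `x` from the base point) of a
tree metric whose threshold graph at distance `1` is `G`. -/
structure IsGromovRep {V : Type*} (G : SimpleGraph V) (m : V → V → ℚ) : Prop where
  symm : ∀ x y, m x y = m y x
  ultra : ∀ x y z, min (m x y) (m y z) ≤ m x z
  nonneg : ∀ x y, 0 ≤ m x y
  adj_iff : ∀ x y, x ≠ y → (G.Adj x y ↔ m x x + m y y - 2 * m x y ≤ 1)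

namespace IsGromovRep

variable {V : Type*} {G : SimpleGraph V} {m : V → V → ℚ}

theorem le_self (h : IsGromovRep G m) (x y : V) : m x y ≤ m x x := by
  simpa [h.symm y x] using h.ultra x y x

theorem le_self' (h : IsGromovRep G m) (x y : V) : m x y ≤ m y y := by
  rw [h.symm]; exact h.le_self y x

theorem comap (h : IsGromovRep G m) {W : Type*} {f : W → V} (hf : f.Injective) :
    IsGromovRep (G.comap f) fun x y => m (f x) (f y) where
  symm _ _ := h.symm _ _
  ultra _ _ _ := h.ultra _ _ _
  nonneg _ _ := h.nonneg _ _
  adj_iff x y hxy := by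
    rw [SimpleGraph.comap_adj]; exact h.adj_iff _ _ (hf.ne hxy)

/-- Scaling the metric by `ε` and lengthening all pendant edges by `(1 - ε) / 2`. -/
theorem rescale [DecidableEq V] (h : IsGromovRep G m) {ε : ℚ} (h0 : 0 < ε) (h1 : ε ≤ 1) :
    IsGromovRep G fun x y => ε * m x y + if x = y then (1 - ε) / 2 else 0 where
  symm x y := by simp only [h.symm x y, eq_comm]
  ultra x y z := by
    have h2 := h.ultra x y z
    have h3 := h.le_self x y
    have h4 := h.le_self' y z
    have h5 : min (ε * m x y) (ε * m y z) ≤ ε * m x z := by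
      rw [← mul_min_of_nonneg _ _ h0.le]; gcongr
    have h6 : ε * m x y ≤ ε * m x x := by gcongr
    by_cases hxz : x = z
    · subst hxz
      refine (min_le_left _ _).trans ?_
      rw [if_pos rfl]
      split_ifs <;> linarith
    · by_cases hxy : x = y
      · subst hxy
        exact (min_le_right _ _)
      · by_cases hyz : y = z
        · subst hyz
          exact (min_le_left _ _)
        · simpa [hxy, hyz, hxz] using h5
  nonneg x y := by
    have := mul_nonneg h0.le (h.nonneg x y)
    split_ifs <;> linarith
  adj_iff x y hxy := by
    rw [h.adj_iff x y hxy]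
    simp only [if_true, if_neg hxy]
    constructor
    · intro h2
      have := mul_le_mul_of_nonneg_left h2 h0.le
      linarith
    · intro h2
      refine le_of_mul_le_mul_left ?_ h0
      linarith

end IsGromovRep

/-- The Gromov products after attaching, at height `t` on the path from the base point to `b`, a new
vertex `u` by an edge of length `r`. -/
noncomputable def attach {V : Type*} (u : V) (m : ({u}ᶜ : Set V) → ({u}ᶜ : Set V) → ℚ)
    (b : ({u}ᶜ : Set V)) (t r : ℚ) (x y : V) : ℚ :=
  open Classical in
  if hx : x = u then
    if hy : y = u then t + r else min t (m b ⟨y, hy⟩)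
  else
    if hy : y = u then min t (m b ⟨x, hx⟩) else m ⟨x, hx⟩ ⟨y, hy⟩

/-- The path to `u` follows the path to `b` up to height `t`, so it parts from the path to `v` at
`min t (m b v)`; `hadj` says that the resulting distances give the right neighbours. -/
theorem IsGromovRep.attach {V : Type*} {G : SimpleGraph V} {u : V}
    {m : ({u}ᶜ : Set V) → ({u}ᶜ : Set V) → ℚ} (h : IsGromovRep (deleteVertex G u) m)
    (b : ({u}ᶜ : Set V)) {t r : ℚ} (ht : 0 ≤ t) (hr : 0 ≤ r)
    (hadj : ∀ v : ({u}ᶜ : Set V), G.Adj u v ↔ t + r + m v v - 2 * min t (m b v) ≤ 1) :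
    IsGromovRep G (attach u m b t r) where
  symm x y := by
    by_cases hx : x = u <;> by_cases hy : y = u <;> simp [LeafPower.attach, hx, hy, h.symm]
  ultra x y z := by
    by_cases hx : x = u <;> by_cases hy : y = u <;> by_cases hz : z = u <;>
      simp only [LeafPower.attach, hx, hy, hz, dite_true, dite_false]
    · simp
    · exact min_le_right _ _
    · refine (min_le_left _ _).trans ((min_le_left _ _).trans (by linarith))
    · refine le_trans ?_ (min_le_min_left t (h.ultra b ⟨y, hy⟩ ⟨z, hz⟩))
      rw [min_assoc]
    · exact min_le_left _ _
    · refine le_trans ?_ (h.ultra ⟨x, hx⟩ b ⟨z, hz⟩)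
      rw [h.symm ⟨x, hx⟩ b]
      exact min_le_min (min_le_right _ _) (min_le_right _ _)
    · refine le_trans ?_ (min_le_min_left t (h.ultra b ⟨y, hy⟩ ⟨x, hx⟩))
      rw [h.symm ⟨x, hx⟩ ⟨y, hy⟩, min_comm, min_assoc]
    · exact h.ultra _ _ _
  nonneg x y := by
    by_cases hx : x = u <;> by_cases hy : y = u <;> simp [LeafPower.attach, hx, hy, h.nonneg, ht]
    linarith
  adj_iff x y hxy := by
    by_cases hx : x = u <;> by_cases hy : y = u
    · exact absurd (hx.trans hy.symm) hxy
    · subst hx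
      simpa [LeafPower.attach, hy] using hadj ⟨y, hy⟩
    · subst hy
      rw [G.adj_comm]
      have := hadj ⟨x, hx⟩
      simp only [LeafPower.attach, hx, dite_true, dite_false]
      rw [this, add_comm (m _ _)]
    · have := h.adj_iff ⟨x, hx⟩ ⟨y, hy⟩ fun e => hxy (congrArg Subtype.val e)
      simpa [LeafPower.attach, hx, hy] using this

/-- A leaf power has a metric `d` whose Gromov products at every base point represent it. -/
theorem IsLeafPower.exists_isGromovRep {V : Type*} {G : SimpleGraph V} (h : IsLeafPower G) :
    ∃ d : V → V → ℚ, (∀ x, d x x = 0) ∧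
      ∀ a, IsGromovRep G fun x y => (d a x + d a y - d x y) / 2 := by
  obtain ⟨N, _, T, w, leaf, hR⟩ := h
  have hT := hR.isTree
  have hw : ∀ e ∈ T.edgeSet, 0 ≤ w e := fun e he => (hR.weight_mem e he).1
  refine ⟨fun x y => treeDist hT w (leaf x) (leaf y), fun x => treeDist_self hT _, fun a => ?_⟩
  refine ⟨fun x y => ?_, fun x y z => ?_, fun x y => ?_, fun x y hxy => ?_⟩
  · simp only [treeDist_comm hT (leaf x) (leaf y), add_comm]
  · have := min_gromov_le hT hw (leaf a) (leaf x) (leaf y) (leaf z)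
    dsimp only
    rw [min_div_div_right (by norm_num : (0 : ℚ) ≤ 2)]
    gcongr
  · have := treeDist_triangle hT hw (leaf x) (leaf a) (leaf y)
    rw [treeDist_comm hT (leaf x) (leaf a)] at this
    linarith
  · rw [hR.adj_iff x y hxy]
    simp only [treeDist_self]
    refine iff_of_eq (congrArg (· ≤ (1 : ℚ)) ?_)
    ring

/-! ### Trees from parent functions -/

section ParentTree

variable {N : Type*}

/-- The graph that joins every node to its parent. -/
def parentGraph (par : N → N) : SimpleGraph N :=
  SimpleGraph.fromRel fun x y => par x = y

theorem parentGraph_adj {par : N → N} {x y : N} :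
    (parentGraph par).Adj x y ↔ x ≠ y ∧ (par x = y ∨ par y = x) := by
  simp [parentGraph]

/-- Descending heights connect every node to the root, and each edge is `s(x, par x)` for some `x ≠
root`, which leaves at most one edge fewer than there are nodes. -/
theorem parentGraph_isTree [Finite N] {par : N → N} {root : N} {ht : N → ℕ}
    (hroot : par root = root) (hht : ∀ x, x ≠ root → ht (par x) < ht x) :
    (parentGraph par).IsTree := by
  have hne : ∀ x, x ≠ root → x ≠ par x := fun x hx e => by
    have := hht x hx
    rw [← e] at this
    exact lt_irrefl _ this
  have hreach : ∀ n x, ht x = n → (parentGraph par).Reachable x root := by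
    intro n
    induction n using Nat.strong_induction_on with
    | _ n ih =>
      intro x hx
      by_cases hxr : x = root
      · rw [hxr]
      · exact (parentGraph_adj.2 ⟨hne x hxr, Or.inl rfl⟩).reachable.trans
          (ih _ (hx ▸ hht x hxr) _ rfl)
  have hconn : (parentGraph par).Connected :=
    { preconnected := fun x y => (hreach _ x rfl).trans (hreach _ y rfl).symm
      nonempty := ⟨root⟩ }
  rw [isTree_iff_connected_and_card]
  refine ⟨hconn, le_antisymm ?_ hconn.card_vert_le_card_edgeSet_add_one⟩
  have hsub : (parentGraph par).edgeSet ⊆ (fun x => s(x, par x)) '' {root}ᶜ := by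
    intro e
    induction e with
    | _ x y =>
      rw [mem_edgeSet, parentGraph_adj]
      rintro ⟨hxy, rfl | rfl⟩
      · refine ⟨x, fun h => hxy ?_, rfl⟩
        rw [Set.mem_singleton_iff] at h
        rw [h, hroot]
      · refine ⟨y, fun h => hxy ?_, Sym2.eq_swap⟩
        rw [Set.mem_singleton_iff] at h
        rw [h, hroot]
  have h1 := (Set.ncard_le_ncard hsub (Set.toFinite _)).trans
    (Set.ncard_image_le (Set.toFinite _))
  have h2 := Set.ncard_add_ncard_compl ({root} : Set N)
  rw [Set.ncard_singleton] at h2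
  have h3 : Nat.card (parentGraph par).edgeSet = (parentGraph par).edgeSet.ncard := rfl
  omega

end ParentTree

/-! ### Realizing integral Gromov products by a tree -/

section Realization

/-- A system of natural-number Gromov products. -/
structure IsNatGromov {V : Type*} (M : V → V → ℕ) : Prop where
  symm : ∀ x y, M x y = M y x
  ultra : ∀ x y z, min (M x y) (M y z) ≤ M x z

variable {V : Type*} {M : V → V → ℕ}

theorem IsNatGromov.le_self (h : IsNatGromov M) (x y : V) : M x y ≤ M x x := by
  simpa [h.symm y x] using h.ultra x y x

/-- The positions `(x, i)`, at height `i` on the path from the base point to `x`; two of them are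
identified when `i` is at most the Gromov product. -/
def positionSetoid (h : IsNatGromov M) : Setoid {p : V × ℕ // p.2 ≤ M p.1 p.1} where
  r p q := p.1.2 = q.1.2 ∧ p.1.2 ≤ M p.1.1 q.1.1
  iseqv :=
    { refl := fun p => ⟨rfl, p.2⟩
      symm := fun {p q} e => ⟨e.1.symm, by rw [h.symm, ← e.1]; exact e.2⟩
      trans := fun {p q r} e e' => ⟨e.1.trans e'.1,
        (le_min e.2 (e.1.le.trans e'.2)).trans (h.ultra p.1.1 q.1.1 r.1.1)⟩ }

/-- Classes of positions. -/
abbrev Position (h : IsNatGromov M) : Type _ := Quotient (positionSetoid h)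

/-- The class of the position at height `i` (cut off at the height of `x`) on the path to `x`. -/
def position (h : IsNatGromov M) (x : V) (i : ℕ) : Position h :=
  Quotient.mk _ ⟨(x, min i (M x x)), min_le_right _ _⟩

namespace Position

variable {h : IsNatGromov M}

theorem exists_eq (q : Position h) : ∃ x i, i ≤ M x x ∧ q = position h x i := by
  induction q using Quotient.inductionOn with
  | _ p =>
    refine ⟨p.1.1, p.1.2, p.2, ?_⟩
    simp only [position, min_eq_left p.2]

theorem position_eq {x y : V} {i : ℕ} (hi : i ≤ M x y) : position h x i = position h y i := by
  refine Quotient.sound ?_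
  have hx := h.le_self x y
  have hy := h.le_self y x
  rw [h.symm y x] at hy
  change min i (M x x) = min i (M y y) ∧ min i (M x x) ≤ M x y
  omega

/-- The height of a position. -/
def height : Position h → ℕ :=
  Quotient.lift (fun p => p.1.2) fun _ _ e => e.1

theorem height_position {x : V} {i : ℕ} (hi : i ≤ M x x) : height (position h x i) = i :=
  min_eq_left hi

theorem le_of_position_eq {x y : V} {i : ℕ} (hi : i ≤ M x x)
    (e : position h x i = position h y i) : i ≤ M x y := by
  have := (Quotient.exact e).2
  simpa [min_eq_left hi] using this

/-- The Gromov product of a vertex and a position. -/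
def gromov (x : V) : Position h → ℕ :=
  Quotient.lift (fun p => min (M x p.1.1) p.1.2) fun p q e => by
    have h1 := h.ultra x p.1.1 q.1.1
    have h2 := h.ultra x q.1.1 p.1.1
    rw [h.symm q.1.1] at h2
    obtain ⟨e1, e2⟩ : p.1.2 = q.1.2 ∧ p.1.2 ≤ M p.1.1 q.1.1 := e
    omega

theorem gromov_position (x : V) {y : V} {i : ℕ} (hi : i ≤ M y y) :
    gromov x (position h y i) = min (M x y) i :=
  congrArg (min (M x y)) (min_eq_left hi)

/-- The next position towards the base point. -/
def down : Position h → Position h :=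
  Quotient.lift (fun p => position h p.1.1 (p.1.2 - 1)) fun p q e => by
    obtain ⟨e1, e2⟩ : p.1.2 = q.1.2 ∧ p.1.2 ≤ M p.1.1 q.1.1 := e
    rw [← e1]
    exact position_eq ((Nat.sub_le _ _).trans e2)

theorem down_position {x : V} {i : ℕ} (hi : i ≤ M x x) :
    down (position h x i) = position h x (i - 1) := by
  change position h x (min i (M x x) - 1) = _
  rw [min_eq_left hi]

end Position

open Position

variable (h : IsNatGromov M)

/-- The parent function of the tree of positions with the vertices as pendant nodes. -/
def parent : Position h ⊕ V → Position h ⊕ V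
  | .inl q => .inl q.down
  | .inr x => .inl (position h x (M x x))

/-- The distance of a node from the base point. -/
def depth : Position h ⊕ V → ℕ
  | .inl q => q.height
  | .inr x => M x x

/-- The tree of positions with the vertices as pendant nodes. -/
abbrev positionTree : SimpleGraph (Position h ⊕ V) := parentGraph (parent h)

/-- Edge weights: the difference of the depths, in units of `1 / K`. -/
def positionWeight (K : ℕ) : Sym2 (Position h ⊕ V) → ℚ :=
  Sym2.lift ⟨fun p q => |(depth h p : ℚ) - depth h q| / K, fun p q => by simp only [abs_sub_comm]⟩

variable {h}

theorem positionWeight_mk (K : ℕ) (p q : Position h ⊕ V) :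
    positionWeight h K s(p, q) = |(depth h p : ℚ) - depth h q| / K := rfl

/-- A node and its parent, in normal form. -/
theorem parent_cases {P : Position h ⊕ V → Position h ⊕ V → Prop}
    (root : ∀ x, P (.inl (position h x 0)) (.inl (position h x 0)))
    (succ : ∀ x i, i + 1 ≤ M x x →
      P (.inl (position h x (i + 1))) (.inl (position h x i)))
    (leaf : ∀ x, P (.inr x) (.inl (position h x (M x x)))) (p : Position h ⊕ V) :
    P p (parent h p) := by
  rcases p with q | x
  · obtain ⟨x, i, hi, rfl⟩ := q.exists_eq
    rw [parent, down_position hi]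
    cases i with
    | zero => exact root x
    | succ i => exact succ x i hi
  · exact leaf x

theorem finite_position [Finite V] : Finite (Position h) :=
  Finite.of_surjective (fun s : Σ x : V, Fin (M x x + 1) => position h s.1 s.2) fun q => by
    obtain ⟨x, i, hi, rfl⟩ := q.exists_eq
    exact ⟨⟨x, i, Nat.lt_succ_of_le hi⟩, rfl⟩

theorem positionTree_isTree [Finite V] [Nonempty V] : (positionTree h).IsTree := by
  obtain ⟨x₀⟩ := ‹Nonempty V›
  have := finite_position (h := h)
  -- Pendant nodes are ranked one above their `depth`: their edge has weight zero but must still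
  -- descend strictly.
  refine parentGraph_isTree (root := .inl (position h x₀ 0))
    (ht := fun p => Sum.elim height (fun x => M x x + 1) p) ?_ fun p => ?_
  · rw [parent, down_position (Nat.zero_le _)]
  · refine parent_cases (P := fun p q => p ≠ .inl (position h x₀ 0) →
      Sum.elim height (fun x => M x x + 1) q < Sum.elim height (fun x => M x x + 1) p) (fun x hx => ?_) (fun x i hi _ => ?_)
      (fun x _ => ?_) p
    · exact absurd (congrArg Sum.inl (position_eq (Nat.zero_le _))) hx
    · simp only [Sum.elim_inl]
      rw [height_position hi, height_position (i.le_succ.trans hi)]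
      exact i.lt_succ_self
    · simp only [Sum.elim_inl, Sum.elim_inr]
      rw [height_position le_rfl]
      exact Nat.lt_succ_self _

/-- A symmetric statement about adjacent nodes follows from the one about nodes and parents. -/
theorem positionTree_adj_induction {P : Position h ⊕ V → Position h ⊕ V → Prop}
    (hsymm : ∀ p q, P p q → P q p) (hP : ∀ p, P p (parent h p)) {p q : Position h ⊕ V}
    (hpq : (positionTree h).Adj p q) : P p q := by
  obtain ⟨-, rfl | rfl⟩ := parentGraph_adj.1 hpq
  · exact hP p
  · exact hsymm _ _ (hP q)

theorem positionWeight_mem {K : ℕ} (hK : 0 < K) (e) (he : e ∈ (positionTree h).edgeSet) :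
    positionWeight h K e ∈ Set.Icc (0 : ℚ) 1 := by
  have hK' : (1 : ℚ) ≤ K := by exact_mod_cast hK
  induction e with
  | _ p q =>
    refine positionTree_adj_induction
      (P := fun p q => positionWeight h K s(p, q) ∈ Set.Icc (0 : ℚ) 1)
      (fun p q e => by rwa [Sym2.eq_swap]) (fun p => ?_) he
    have key : ∀ p q : Position h ⊕ V, |(depth h p : ℚ) - depth h q| ≤ 1 →
        positionWeight h K s(p, q) ∈ Set.Icc (0 : ℚ) 1 := fun p q e =>
      ⟨by rw [positionWeight_mk]; positivity, by
        rw [positionWeight_mk, div_le_one (by linarith)]; exact e.trans hK'⟩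
    refine parent_cases (P := fun p q => positionWeight h K s(p, q) ∈ Set.Icc (0 : ℚ) 1)
      (fun x => key _ _ ?_) (fun x i hi => key _ _ ?_) (fun x => key _ _ ?_) p
    · simp
    · simp only [depth]
      rw [height_position hi, height_position (i.le_succ.trans hi)]
      simp
    · simp only [depth]
      rw [height_position le_rfl]
      simp

theorem positionTree_adj_succ {x : V} {i : ℕ} (hi : i + 1 ≤ M x x) :
    (positionTree h).Adj (.inl (position h x i)) (.inl (position h x (i + 1))) := by
  refine parentGraph_adj.2 ⟨fun e => ?_, Or.inr ?_⟩
  · have := congrArg height (Sum.inl_injective e)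
    rw [height_position hi, height_position (i.le_succ.trans hi)] at this
    omega
  · rw [parent, down_position hi, Nat.add_sub_cancel]

theorem positionTree_adj_leaf (x : V) :
    (positionTree h).Adj (.inl (position h x (M x x))) (.inr x) :=
  parentGraph_adj.2 ⟨Sum.inl_ne_inr, Or.inr rfl⟩

theorem treeDist_position_le (hT : (positionTree h).IsTree) {K : ℕ} (hK : 0 < K) {x : V} {j i : ℕ}
    (hji : j ≤ i) (hi : i ≤ M x x) :
    treeDist hT (positionWeight h K) (.inl (position h x j)) (.inl (position h x i)) ≤
      ((i : ℚ) - j) / K := by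
  induction i, hji using Nat.le_induction with
  | base => simp [treeDist_self]
  | succ i hji ih =>
    have hi' := i.le_succ.trans hi
    refine (treeDist_triangle hT (fun e he => (positionWeight_mem hK e he).1) _
      (.inl (position h x i)) _).trans ?_
    rw [treeDist_of_adj hT (positionTree_adj_succ hi), positionWeight_mk]
    simp only [depth]
    rw [height_position hi, height_position hi']
    push_cast
    rw [show (i : ℚ) - (i + 1) = -1 by ring, abs_neg, abs_one]
    have := ih hi'
    rw [show ((i : ℚ) + 1 - j) / K = (i - j) / K + 1 / K by ring]
    linarith

theorem treeDist_leaf_le (hT : (positionTree h).IsTree) {K : ℕ} (hK : 0 < K) {x : V} {j : ℕ}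
    (hj : j ≤ M x x) :
    treeDist hT (positionWeight h K) (.inl (position h x j)) (.inr x) ≤ ((M x x : ℚ) - j) / K := by
  refine (treeDist_triangle hT (fun e he => (positionWeight_mem hK e he).1) _
      (.inl (position h x (M x x))) _).trans ?_
  rw [treeDist_of_adj hT (positionTree_adj_leaf x), positionWeight_mk]
  simp only [depth]
  rw [height_position le_rfl]
  simpa using treeDist_position_le hT hK hj le_rfl

/-- The distance from a vertex `x` to a node, minus the distance from `x` to the base point, in units
of `1 / K`. -/
def busemann (h : IsNatGromov M) (x : V) : Position h ⊕ V → ℚ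
  | .inl q => q.height - 2 * q.gromov x
  | .inr y => M y y - 2 * M x y

/-- One step up raises the height by one and the product with `x` by zero or one, so the difference
changes by exactly one; pendant edges change nothing. -/
theorem abs_busemann_sub_le (x : V) (p : Position h ⊕ V) :
    |busemann h x p - busemann h x (parent h p)| ≤ |(depth h p : ℚ) - depth h (parent h p)| := by
  refine parent_cases (P := fun p q => |busemann h x p - busemann h x q| ≤
    |(depth h p : ℚ) - depth h q|) (fun y => ?_) (fun y i hi => ?_) (fun y => ?_) p
  · simp
  · have hi' := i.le_succ.trans hi
    simp only [busemann, depth]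
    rw [height_position hi, height_position hi', gromov_position x hi, gromov_position x hi']
    rcases le_total (i + 1) (M x y) with e | e
    · rw [min_eq_right e, min_eq_right (i.le_succ.trans e)]
      push_cast
      rw [abs_le]; constructor <;> norm_num <;> linarith
    · rcases e.eq_or_lt with e | e
      · rw [e, min_self, min_eq_right i.le_succ]
        push_cast
        rw [abs_le]; constructor <;> norm_num <;> linarith
      · rw [min_eq_left e.le, min_eq_left (Nat.lt_succ_iff.1 e)]
        push_cast
        rw [abs_le]; constructor <;> norm_num
  · have e : M x y ≤ M y y := h.symm y x ▸ h.le_self y x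
    simp only [busemann, depth]
    rw [height_position le_rfl, gromov_position x le_rfl, min_eq_left e]
    simp

/-- The upper bound goes through the position where the paths to `x` and `y` part; the lower bound
holds because `busemann h x p / K` is `1`-Lipschitz. -/
theorem treeDist_leaves (hT : (positionTree h).IsTree) {K : ℕ} (hK : 0 < K) (x y : V) :
    treeDist hT (positionWeight h K) (.inr x) (.inr y) =
      ((M x x : ℚ) + M y y - 2 * M x y) / K := by
  have hw := fun e he => (positionWeight_mem (h := h) hK e he).1
  have hx := h.le_self x y
  have hy : M x y ≤ M y y := h.symm y x ▸ h.le_self y x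
  refine le_antisymm ?_ ?_
  · refine (treeDist_triangle hT hw _ (.inl (position h x (M x y))) _).trans ?_
    rw [treeDist_comm hT (.inr x)]
    have h1 := treeDist_leaf_le hT hK hx
    have h2 := treeDist_leaf_le hT hK hy
    rw [← position_eq (h := h) (le_refl (M x y))] at h2
    calc _ ≤ _ := add_le_add h1 h2
      _ = _ := by ring
  · have := sub_le_treeDist (w := positionWeight h K) hT (fun p => busemann h x p / K)
      (fun p q hpq => ?_) (.inr x) (.inr y)
    · refine le_trans (le_of_eq ?_) this
      simp only [busemann]
      ring
    · have := positionTree_adj_induction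
        (P := fun p q => |busemann h x p - busemann h x q| ≤ |(depth h p : ℚ) - depth h q|)
        (fun p q e => by rwa [abs_sub_comm, abs_sub_comm (depth h q : ℚ)])
        (abs_busemann_sub_le x) hpq
      rw [positionWeight_mk, ← sub_div]
      gcongr
      exact (le_abs_self _).trans (by rwa [abs_sub_comm])

/-- Every position `(x, i)` has a child in the direction of `x`. -/
theorem exists_child {x : V} {i : ℕ} (hi : i ≤ M x x) :
    ∃ c, (positionTree h).Adj (.inl (position h x i)) c ∧
      (c = .inr x ∨ i + 1 ≤ M x x ∧ c = .inl (position h x (i + 1))) := by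
  rcases hi.eq_or_lt with rfl | hi
  · exact ⟨_, positionTree_adj_leaf x, Or.inl rfl⟩
  · exact ⟨_, positionTree_adj_succ hi, Or.inr ⟨hi, rfl⟩⟩

theorem isLeaf_inr (x : V) : IsLeaf (positionTree h) (.inr x) := by
  rw [IsLeaf, Set.encard_le_one_iff]
  have : ∀ c, (positionTree h).Adj (.inr x) c → c = .inl (position h x (M x x)) := by
    intro c hc
    obtain ⟨-, e | e⟩ := parentGraph_adj.1 hc
    · exact e.symm
    · rcases c with c | c <;> simp [parent] at e
  intro a b ha hb
  rw [this a ha, this b hb]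

/-- The base position branches towards `x₀` and `y₀` because their product is zero; any other
position has both a parent and a child. -/
theorem not_isLeaf_inl {x₀ y₀ : V} (hne : x₀ ≠ y₀) (h0 : M x₀ y₀ = 0) (q : Position h) :
    ¬ IsLeaf (positionTree h) (.inl q) := by
  rw [IsLeaf, Set.encard_le_one_iff]
  intro hq
  obtain ⟨x, i, hi, rfl⟩ := q.exists_eq
  cases i with
  | zero =>
    rw [position_eq (Nat.zero_le (M x x₀))] at hq
    obtain ⟨c, hc, hc'⟩ := exists_child (h := h) (Nat.zero_le (M x₀ x₀))
    obtain ⟨d, hd, hd'⟩ := exists_child (h := h) (Nat.zero_le (M y₀ y₀))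
    rw [← position_eq (Nat.zero_le (M x₀ y₀))] at hd
    have e := hq c d hc hd
    rcases hc' with rfl | ⟨hx, rfl⟩ <;> rcases hd' with rfl | ⟨hy, rfl⟩
    · exact hne (Sum.inr_injective e)
    · exact Sum.inr_ne_inl e
    · exact Sum.inl_ne_inr e
    · have := le_of_position_eq hx (Sum.inl_injective e)
      omega
  | succ i =>
    obtain ⟨c, hc, hc'⟩ := exists_child (h := h) hi
    have e := hq c (.inl (position h x i)) hc (positionTree_adj_succ hi).symm
    rcases hc' with rfl | ⟨hx, rfl⟩
    · exact Sum.inr_ne_inl e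
    · have := congrArg height (Sum.inl_injective e)
      rw [height_position hx, height_position (i.le_succ.trans hi)] at this
      omega

theorem isLeafRoot_positionTree [Finite V] {G : SimpleGraph V} {K : ℕ} (hK : 0 < K)
    (hadj : ∀ x y, x ≠ y → (G.Adj x y ↔ M x x + M y y ≤ 2 * M x y + K)) {x₀ y₀ : V}
    (hne : x₀ ≠ y₀) (h0 : M x₀ y₀ = 0) :
    IsLeafRoot G (positionTree h) (positionWeight h K) Sum.inr where
  isTree := have : Nonempty V := ⟨x₀⟩; positionTree_isTree
  weight_mem := positionWeight_mem hK
  leaf_injective := Sum.inr_injective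
  range_leaf := by
    ext p
    rcases p with q | x
    · simpa using not_isLeaf_inl hne h0 q
    · simpa using isLeaf_inr x
  adj_iff x y hxy := by
    rw [hadj x y hxy, treeDist_leaves _ hK, div_le_one (by exact_mod_cast hK), sub_le_iff_le_add']
    norm_cast

end Realization

/-! ### From rational Gromov products to leaf roots -/

/-- A finite family of nonnegative rationals has a common denominator. -/
theorem exists_common_denominator {ι : Type*} [Finite ι] (f : ι → ℚ) (hf : ∀ i, 0 ≤ f i) :
    ∃ K : ℕ, 0 < K ∧ ∃ g : ι → ℕ, ∀ i, (g i : ℚ) = K * f i := by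
  have := Fintype.ofFinite ι
  refine ⟨∏ i, (f i).den, Finset.prod_pos fun i _ => (f i).den_pos, ?_⟩
  have : ∀ i, ∃ n : ℕ, (n : ℚ) = ((∏ i, (f i).den : ℕ) : ℚ) * f i := by
    intro i
    obtain ⟨c, hc⟩ := Finset.dvd_prod_of_mem (fun i => (f i).den) (Finset.mem_univ i)
    refine ⟨c * (f i).num.toNat, ?_⟩
    have h1 : (((f i).num.toNat : ℕ) : ℚ) = (f i).num := by
      exact_mod_cast Int.toNat_of_nonneg (Rat.num_nonneg.2 (hf i))
    rw [hc]
    push_cast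
    rw [h1, mul_comm ((f i).den : ℚ), mul_assoc, Rat.den_mul_eq_num]
  choose g hg using this
  exact ⟨g, hg⟩

theorem IsLeafPower.of_equiv {V W : Type*} {G : SimpleGraph V} (e : W ≃ V)
    (h : IsLeafPower (G.comap e)) : IsLeafPower G := by
  obtain ⟨N, hN, T, w, leaf, hR⟩ := h
  refine ⟨N, hN, T, w, leaf ∘ e.symm, hR.isTree, hR.weight_mem,
    hR.leaf_injective.comp e.symm.injective, ?_, fun x y hxy => ?_⟩
  · rw [e.symm.surjective.range_comp, hR.range_leaf]
  · simpa using hR.adj_iff (e.symm x) (e.symm y) (e.symm.injective.ne hxy)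

theorem isLeafPower_of_subsingleton {V : Type*} [Subsingleton V] [Nonempty V] (G : SimpleGraph V) :
    IsLeafPower G := by
  refine ⟨Unit, inferInstance, ⊥, 0, fun _ => (), IsTree.of_subsingleton, ?_,
    Function.injective_of_subsingleton _, ?_, fun x y hxy => absurd (Subsingleton.elim x y) hxy⟩
  · simp
  · ext
    simp [IsLeaf]

/-- The nodes of the position tree live in the universe of `V`, while a leaf root needs nodes in
`Type`; the general case is transported from `Fin n`. -/
theorem IsGromovRep.isLeafPower_of_type {V : Type} [Finite V] [Nontrivial V] {G : SimpleGraph V}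
    {m : V → V → ℚ} (h : IsGromovRep G m) : IsLeafPower G := by
  obtain ⟨K, hK, g, hg⟩ := exists_common_denominator (fun p : V × V => m p.1 p.2)
    fun p => h.nonneg _ _
  have hK' : (0 : ℚ) < K := by exact_mod_cast hK
  have hle : ∀ p q : V × V, g p ≤ g q ↔ m p.1 p.2 ≤ m q.1 q.2 := fun p q => by
    rw [← Nat.cast_le (α := ℚ), hg, hg, mul_le_mul_iff_right₀ hK']
  have hS : Nonempty {p : V × V // p.1 ≠ p.2} := by
    obtain ⟨x, y, hxy⟩ := exists_pair_ne V
    exact ⟨⟨(x, y), hxy⟩⟩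
  -- Subtracting the least off-diagonal product preserves distances and moves the base point to a
  -- branching node, so that it is not a leaf.
  obtain ⟨⟨p₀, hp₀⟩, hmin⟩ := Finite.exists_min fun p : {p : V × V // p.1 ≠ p.2} => g p
  have hmin' : ∀ x y, g p₀ ≤ g (x, y) := by
    intro x y
    by_cases hxy : x = y
    · subst hxy
      obtain ⟨z, hz⟩ := exists_ne x
      exact (hmin ⟨(x, z), hz.symm⟩).trans ((hle _ _).2 (h.le_self x z))
    · exact hmin ⟨(x, y), hxy⟩
  have hM : IsNatGromov fun x y => g (x, y) - g p₀ := by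
    refine ⟨fun x y => ?_, fun x y z => ?_⟩
    · congr 1
      exact le_antisymm ((hle _ _).2 (h.symm x y).le) ((hle _ _).2 (h.symm y x).le)
    · have := h.ultra x y z
      rw [min_le_iff] at this
      rcases this with e | e
      · exact (min_le_left _ _).trans (Nat.sub_le_sub_right ((hle (x, y) (x, z)).2 e) _)
      · exact (min_le_right _ _).trans (Nat.sub_le_sub_right ((hle (y, z) (x, z)).2 e) _)
  have := finite_position (h := hM)
  refine ⟨_, inferInstance, _, _, _, isLeafRoot_positionTree (h := hM) hK (fun x y hxy => ?_) hp₀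
    (Nat.sub_self _)⟩
  rw [h.adj_iff x y hxy, ← mul_le_mul_iff_right₀ hK']
  have h1 := hmin' x x
  have h2 := hmin' y y
  have h3 := hmin' x y
  -- By `h1`, `h2`, `h3` no truncation occurs in these subtractions.
  have : g (x, x) - g p₀ + (g (y, y) - g p₀) ≤ 2 * (g (x, y) - g p₀) + K ↔
      g (x, x) + g (y, y) ≤ 2 * g (x, y) + K := by omega
  rw [this, ← Nat.cast_le (α := ℚ)]
  push_cast
  rw [hg, hg, hg]
  constructor <;> intro e <;> linarith

theorem IsGromovRep.isLeafPower {V : Type*} [Finite V] [Nonempty V] {G : SimpleGraph V}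
    {m : V → V → ℚ} (h : IsGromovRep G m) : IsLeafPower G := by
  rcases subsingleton_or_nontrivial V with hV | hV
  · exact isLeafPower_of_subsingleton G
  · obtain ⟨n, ⟨e⟩⟩ := Finite.exists_equiv_fin V
    have : Nontrivial (Fin n) := e.symm.nontrivial
    exact IsLeafPower.of_equiv e.symm (h.comap e.symm.injective).isLeafPower_of_type

/-! ### Deleting a vertex; universal vertices, degree one, maximal cliques -/

variable {V : Type*} {G : SimpleGraph V}

theorem IsLeafPower.deleteVertex [Finite V] [Nontrivial V] (h : IsLeafPower G) (u : V) :
    IsLeafPower (deleteVertex G u) := by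
  obtain ⟨d, -, hd⟩ := h.exists_isGromovRep
  obtain ⟨v, hv⟩ := exists_ne u
  have : Nonempty ({u}ᶜ : Set V) := ⟨⟨v, hv⟩⟩
  -- The base point need not be a vertex of the graph represented, so `u` itself serves.
  exact ((hd u).comap (f := ((↑) : ({u}ᶜ : Set V) → V)) Subtype.val_injective).isLeafPower

variable [Finite V] {u : V}

theorem isLeafPower_of_isUniversal [Nontrivial V] (hu : G.IsUniversal u)
    (h : IsLeafPower (deleteVertex G u)) : IsLeafPower G := by
  classical
  obtain ⟨d, -, hd⟩ := h.exists_isGromovRep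
  obtain ⟨b₀, hb₀⟩ := exists_ne u
  let b : ({u}ᶜ : Set V) := ⟨b₀, hb₀⟩
  have hm := hd b
  set m : ({u}ᶜ : Set V) → ({u}ᶜ : Set V) → ℚ := fun x y => (d b x + d b y - d x y) / 2
  have : Nonempty ({u}ᶜ : Set V) := ⟨b⟩
  obtain ⟨x, hx⟩ := Finite.exists_max fun x => m x x
  have hpos : 0 < 1 + 2 * m x x := by linarith [hm.nonneg x x]
  -- This `ε` gives `ε * m x x = (1 - ε) / 2`, so every vertex ends up within `1 - ε` of the base
  -- point, where `u` is placed.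
  have hε := hm.rescale (ε := 1 / (1 + 2 * m x x)) (by positivity)
    (by rw [div_le_one hpos]; linarith [hm.nonneg x x])
  refine (hε.attach b le_rfl le_rfl fun v => ?_).isLeafPower
  refine iff_of_true (hu (Ne.symm v.2)) ?_
  rw [min_eq_left (hε.nonneg _ _), if_pos rfl]
  have h1 : 1 / (1 + 2 * m x x) * m v v ≤ 1 / (1 + 2 * m x x) * m x x := by
    gcongr
    exact hx v
  have h2 : 1 / (1 + 2 * m x x) * (1 + 2 * m x x) = 1 := one_div_mul_cancel hpos.ne'
  have h3 : 0 < 1 / (1 + 2 * m x x) := by positivity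
  linarith

theorem isLeafPower_of_existsUnique_adj (hu : ∃! v, G.Adj u v)
    (h : IsLeafPower (deleteVertex G u)) : IsLeafPower G := by
  classical
  obtain ⟨d, -, hd⟩ := h.exists_isGromovRep
  obtain ⟨b₀, hb₀, huniq⟩ := hu
  let b : ({u}ᶜ : Set V) := ⟨b₀, hb₀.ne'⟩
  have hm := hd b
  set m : ({u}ᶜ : Set V) → ({u}ᶜ : Set V) → ℚ := fun x y => (d b x + d b y - d x y) / 2
  -- Rescaling keeps distinct vertices at least `1 / 2` apart, so a pendant edge of length `1` at
  -- `b` reaches `b` alone.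
  have hε := hm.rescale (ε := 1 / 2) (by norm_num) (by norm_num)
  have : Nonempty V := ⟨u⟩
  refine (hε.attach b (hε.nonneg b b) zero_le_one fun v => ?_).isLeafPower
  rw [min_eq_right (hε.le_self b v)]
  by_cases hv : b = v
  · subst hv
    refine iff_of_true hb₀ ?_
    linarith
  · refine iff_of_false (fun e => hv (Subtype.ext (huniq v e).symm)) ?_
    have h1 := hm.le_self b v
    have h2 := hm.le_self' b v
    simp only [if_true, if_neg hv]
    linarith

theorem isLeafPower_of_maximal_isClique [Nontrivial V]
    (hu : Maximal (deleteVertex G u).IsClique (nbhd G u))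
    (h : IsLeafPower (deleteVertex G u)) : IsLeafPower G := by
  obtain ⟨d, hd0, hd⟩ := h.exists_isGromovRep
  -- An empty clique would extend to a single vertex; nonemptiness provides the diametral pair `x`,
  -- `y` (possibly equal).
  have hne : (nbhd G u).Nonempty := by
    rw [Set.nonempty_iff_ne_empty]
    intro h0
    obtain ⟨v, hv⟩ := exists_ne u
    have := hu.2 (y := {⟨v, hv⟩}) (by simp) (h0 ▸ Set.empty_subset _) rfl
    rw [h0] at this
    exact this
  have : Nonempty (nbhd G u) := hne.to_subtype
  obtain ⟨⟨x, y⟩, hxy⟩ := Finite.exists_max fun p : nbhd G u × nbhd G u => d p.1 p.2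
  have hm := hd x
  have hmxx : (d x x + d x x - d x x) / 2 = 0 := by rw [hd0]; norm_num
  have hmvv : ∀ v : ({u}ᶜ : Set V), (d x v + d x v - d v v) / 2 = d x v := by
    intro v; rw [hd0]; ring
  have hle : ∀ v ∈ nbhd G u, ∀ w ∈ nbhd G u, d v w ≤ d x y := fun v hv w hw =>
    hxy (⟨v, hv⟩, ⟨w, hw⟩)
  have hadj : ∀ v w : ({u}ᶜ : Set V), v ≠ w → ((deleteVertex G u).Adj v w ↔ d v w ≤ 1) := by
    intro v w hvw
    rw [hm.adj_iff v w hvw, hd0, hd0]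
    refine iff_of_eq (congrArg (· ≤ (1 : ℚ)) ?_)
    ring
  have hxy1 : d x y ≤ 1 := by
    by_cases e : (x : ({u}ᶜ : Set V)) = y
    · rw [e, hd0]; exact zero_le_one
    · exact (hadj _ _ e).1 (hu.1 x.2 y.2 e)
  have hxy0 : 0 ≤ d x y := by
    have := hm.nonneg y y
    rwa [hmvv] at this
  have hsym : ∀ v w, d v w = d w v := by
    intro v w
    have := hm.symm v w
    linarith
  have : Nonempty V := ⟨u⟩
  -- At the midpoint of the pair, `u` reaches exactly the vertices within `d x y / 2` of it, that
  -- is, those within `d x y` of both `x` and `y`.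
  refine (hm.attach y (t := d x y / 2) (r := 1 - d x y / 2) (by linarith) (by linarith)
    fun v => ?_).isLeafPower
  rw [hmvv]
  have key : d x y / 2 + (1 - d x y / 2) + d x v - 2 * min (d x y / 2)
      ((d x y + d x v - d y v) / 2) ≤ 1 ↔ d x v ≤ d x y ∧ d y v ≤ d x y := by
    constructor
    · intro e
      constructor
      · linarith [min_le_left (d x y / 2) ((d x y + d x v - d y v) / 2)]
      · linarith [min_le_right (d x y / 2) ((d x y + d x v - d y v) / 2)]
    · rintro ⟨e1, e2⟩
      have : d x v / 2 ≤ min (d x y / 2) ((d x y + d x v - d y v) / 2) :=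
        le_min (by linarith) (by linarith)
      linarith
  rw [key]
  change v ∈ nbhd G u ↔ _
  refine ⟨fun hv => ⟨hle _ x.2 _ hv, hle _ y.2 _ hv⟩, fun ⟨e1, e2⟩ => ?_⟩
  -- By the ultrametric inequality through `y`, such a `v` is within `d x y ≤ 1` of the whole
  -- clique, so maximality puts it inside.
  have hclique : (deleteVertex G u).IsClique (insert v (nbhd G u)) := by
    refine hu.1.insert fun w hw hvw => ?_
    rw [hadj v w hvw]
    have h1 := hm.ultra v y w
    have h2 := hle _ x.2 _ hw
    have h3 := hle _ y.2 _ hw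
    rw [min_le_iff] at h1
    rcases h1 with h1 | h1
    · linarith [hsym v y]
    · linarith
  exact hu.2 hclique (Set.subset_insert _ _) (Set.mem_insert _ _)

/-! ### Minimal separators -/

/-- Reachability by walks that avoid `S`. -/
def ReachableAvoiding {W : Type*} (H : SimpleGraph W) (S : Set W) : W → W → Prop :=
  Relation.ReflTransGen fun x y => H.Adj x y ∧ x ∉ S ∧ y ∉ S

section Separators

variable {W : Type*} {H : SimpleGraph W} {S : Set W} {a b : W}

theorem ReachableAvoiding.symm (h : ReachableAvoiding H S a b) : ReachableAvoiding H S b a := by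
  have : Std.Symm fun x y => H.Adj x y ∧ x ∉ S ∧ y ∉ S := ⟨fun _ _ e => ⟨e.1.symm, e.2.2, e.2.1⟩⟩
  exact Relation.ReflTransGen.stdSymm.symm _ _ h

theorem ReachableAvoiding.notMem (ha : a ∉ S) (h : ReachableAvoiding H S a b) : b ∉ S := by
  rcases Relation.ReflTransGen.cases_tail h with rfl | ⟨c, -, hc⟩
  · exact ha
  · exact hc.2.2

theorem ReachableAvoiding.exists_walk (ha : a ∉ S) (h : ReachableAvoiding H S a b) :
    ∃ p : H.Walk a b, ∀ v ∈ p.support, v ∉ S := by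
  induction h with
  | refl => exact ⟨.nil, by simpa using ha⟩
  | tail _ e ih =>
    obtain ⟨p, hp⟩ := ih
    refine ⟨p.concat e.1, fun v hv => ?_⟩
    rw [Walk.support_concat, List.mem_append, List.mem_singleton] at hv
    rcases hv with hv | rfl
    · exact hp v hv
    · exact e.2.2

theorem Separates.not_reachableAvoiding (h : Separates H S a b) : ¬ ReachableAvoiding H S a b := by
  intro e
  obtain ⟨p, hp⟩ := e.exists_walk h.1
  obtain ⟨s, hs, hs'⟩ := h.2.2 p
  exact hp s hs hs'

theorem Separates.symm (h : Separates H S a b) : Separates H S b a :=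
  ⟨h.2.1, h.1, fun p => by simpa using h.2.2 p.reverse⟩

theorem minimal_separates_symm (h : Minimal (fun X => Separates H X a b) S) :
    Minimal (fun X => Separates H X b a) S :=
  ⟨h.1.symm, fun _ hX => h.2 hX.symm⟩

/-- Every vertex of a minimal separator of `a` and `b` has a neighbour in the component of `a`. -/
theorem exists_adj_of_minimal_separates (h : Minimal (fun X => Separates H X a b) S) {s : W}
    (hs : s ∈ S) : ∃ v, ReachableAvoiding H S a v ∧ H.Adj v s := by
  by_contra! hno
  -- If `s` has no neighbour in the component of `a`, a walk from there avoiding `S \ {s}` cannot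
  -- enter `s` either, so `S \ {s}` already separates.
  have key : ∀ {x y : W} (p : H.Walk x y), ReachableAvoiding H S a x →
      (∀ v ∈ p.support, v ∉ S \ {s}) → ReachableAvoiding H S a y := by
    intro x y p
    induction p with
    | nil => exact fun hx _ => hx
    | @cons x z y hxz p ih =>
      intro hx hp
      rw [Walk.support_cons] at hp
      refine ih (hx.tail ⟨hxz, hx.notMem h.1.1, fun hz => ?_⟩) fun v hv =>
        hp v (List.mem_cons_of_mem _ hv)
      have hzs : z = s := by
        by_contra hzs
        exact hp z (List.mem_cons_of_mem _ p.start_mem_support) ⟨hz, hzs⟩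
      exact hno x hx (hzs ▸ hxz)
  have hsep : Separates H (S \ {s}) a b := by
    refine ⟨fun e => h.1.1 e.1, fun e => h.1.2.1 e.1, fun p => ?_⟩
    by_contra! hp
    exact h.1.not_reachableAvoiding (key p .refl hp)
  exact (h.2 hsep Set.sdiff_subset hs).2 rfl

end Separators

/-- Let the vertex `v` project to position `g v` of a path starting at `a`, at distance `h v` from the
path. Then the balls of radius `1 / 2` around the vertices reachable from `a` cover an initial segment
of the path. -/
theorem exists_ball_covering {W : Type*} {R : W → W → Prop} {g h : W → ℚ} {a : W} (ha : h a = 0)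
    (hga : g a = 0)
    (hR : ∀ v w, R v w → g w - max 0 (1 / 2 - h w) ≤ g v + max 0 (1 / 2 - h v)) {v : W}
    (hv : Relation.ReflTransGen R a v) {t : ℚ} (ht : 0 ≤ t) (htv : t ≤ g v + max 0 (1 / 2 - h v)) :
    ∃ w, Relation.ReflTransGen R a w ∧ h w + |t - g w| ≤ 1 / 2 := by
  induction hv with
  | refl =>
    refine ⟨a, .refl, ?_⟩
    rw [ha, hga, max_eq_right (by norm_num)] at htv
    rw [ha, hga, sub_zero, abs_of_nonneg ht]
    linarith
  | @tail v w hv hvw ih =>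
    rcases le_or_gt t (g v + max 0 (1 / 2 - h v)) with e | e
    · exact ih e
    · refine ⟨w, hv.tail hvw, ?_⟩
      have h1 := (hR v w hvw).trans_lt e
      rcases max_cases 0 (1 / 2 - h w) with ⟨h2, -⟩ | ⟨h2, -⟩
      · rw [h2] at h1 htv
        linarith
      · rw [h2] at h1 htv
        have : |t - g w| ≤ 1 / 2 - h w := abs_le.2 ⟨by linarith, by linarith⟩
        linarith

theorem isLeafPower_of_isMinimalSeparator (hu : IsMinimalSeparator (deleteVertex G u) (nbhd G u))
    (h : IsLeafPower (deleteVertex G u)) : IsLeafPower G := by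
  obtain ⟨a, b, hS⟩ := hu
  obtain ⟨d, hd0, hd⟩ := h.exists_isGromovRep
  have hm := hd a
  have hmaa : (d a a + d a a - d a a) / 2 = 0 := by rw [hd0]; norm_num
  set m : ({u}ᶜ : Set V) → ({u}ᶜ : Set V) → ℚ := fun x y => (d a x + d a y - d x y) / 2 with hmdef
  clear_value m
  replace hmaa : m a a = 0 := by rw [hmdef]; exact hmaa
  clear hmdef hd hd0
  set S := nbhd G u with hSdef
  set H := deleteVertex G u
  -- With base point `a`, `g v` is the position on the path from `a` to `b` at which `v` projects,
  -- and `k v` is the distance of `v` from the path.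
  set g : ({u}ᶜ : Set V) → ℚ := fun v => m b v with hg
  set k : ({u}ᶜ : Set V) → ℚ := fun v => m v v - m b v with hk
  have hk0 : ∀ v, 0 ≤ k v := fun v => sub_nonneg.2 (hm.le_self' b v)
  have hg0 : ∀ v, 0 ≤ g v := fun v => hm.nonneg b v
  have hgb : ∀ v, g v ≤ g b := fun v => hm.le_self b v
  have hga : g a = 0 := le_antisymm ((hm.le_self' b a).trans hmaa.le) (hg0 a)
  have hka : k a = 0 := by simp only [hk]; rw [hmaa]; change 0 - g a = 0; rw [hga, sub_zero]
  have hkb : k b = 0 := sub_self _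
  have hdist : ∀ v w, m v v + m w w - 2 * m v w ≤ k v + k w + |g v - g w| := by
    intro v w
    have := hm.ultra v b w
    rw [hm.symm v b] at this
    simp only [hg, hk]
    rcases le_total (m b v) (m b w) with e | e
    · rw [min_eq_left e] at this
      linarith [neg_abs_le (m b v - m b w)]
    · rw [min_eq_right e] at this
      linarith [le_abs_self (m b v - m b w)]
  have hball : ∀ {v w : ({u}ᶜ : Set V)} {t : ℚ}, k v + |t - g v| ≤ 1 / 2 →
      k w + |t - g w| ≤ 1 / 2 → v ≠ w → H.Adj v w := by
    intro v w t h1 h2 hvw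
    rw [hm.adj_iff v w hvw]
    have := abs_sub_le (g v) t (g w)
    rw [abs_sub_comm (g v) t] at this
    linarith [hdist v w]
  -- The intervals of adjacent vertices leave no gap; `max 0` shrinks the interval of a vertex
  -- farther than `1 / 2` from the path to its projection.
  have hends : ∀ v w, H.Adj v w →
      g w - max 0 (1 / 2 - k w) ≤ g v + max 0 (1 / 2 - k v) := by
    intro v w hvw
    have h1 := le_max_left 0 (1 / 2 - k v)
    have h2 := le_max_left 0 (1 / 2 - k w)
    have h3 := le_max_right 0 (1 / 2 - k v)
    have h4 := le_max_right 0 (1 / 2 - k w)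
    rcases le_or_gt (g w) (g v) with e | e
    · linarith
    · have h5 := (hm.adj_iff v w hvw.ne).1 hvw
      have h6 : m v w ≤ g v := by
        have := hm.ultra b w v
        rw [hm.symm w v, min_le_iff] at this
        exact this.resolve_left (not_le.2 e)
      have h7 : k v + k w + g w - g v ≤ 1 := by
        simp only [hg, hk] at h6 ⊢
        linarith
      linarith
  have hA := fun {v} (hv : ReachableAvoiding H S a v) {t : ℚ} (ht : 0 ≤ t)
    (htv : t ≤ g v + max 0 (1 / 2 - k v)) =>
    exists_ball_covering (g := g) (h := k) hka hga (fun v w e => hends v w e.1) hv ht htv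
  have hB : ∀ {v}, ReachableAvoiding H S b v → ∀ {t : ℚ}, t ≤ g b →
      g v - max 0 (1 / 2 - k v) ≤ t → ∃ w, ReachableAvoiding H S b w ∧ k w + |t - g w| ≤ 1 / 2 := by
    intro v hv t ht htv
    obtain ⟨w, hw, hw'⟩ := exists_ball_covering (g := fun v => g b - g v) (h := k) (t := g b - t)
      hkb (sub_self _) (fun v w e => by linarith [hends w v e.1.symm]) hv (by linarith)
      (by linarith)
    refine ⟨w, hw, ?_⟩
    rwa [show g b - t - (g b - g w) = -(t - g w) by ring, abs_neg] at hw'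
  have hdisj : ∀ {v w}, ReachableAvoiding H S a v → ReachableAvoiding H S b w →
      ¬ (v = w ∨ H.Adj v w) := by
    intro v w hv hw e
    have hw' : ReachableAvoiding H S a w := by
      rcases e with rfl | e
      · exact hv
      · exact hv.tail ⟨e, hv.notMem hS.1.1, hw.notMem hS.1.2.1⟩
    exact hS.1.not_reachableAvoiding (hw'.trans hw.symm)
  have hlt : ∀ {v w}, ReachableAvoiding H S a v → ReachableAvoiding H S b w →
      g v + max 0 (1 / 2 - k v) < g w - max 0 (1 / 2 - k w) := by
    intro v w hv hw
    by_contra! hle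
    have h1 := le_max_left 0 (1 / 2 - k v)
    have h2 := le_max_left 0 (1 / 2 - k w)
    -- If the two sides overlapped, this point would be covered from both components, giving equal
    -- or adjacent vertices. The cut-off at `0` keeps it on the path.
    obtain ⟨v', hv', e1⟩ := hA hv (le_max_left 0 _)
      (max_le (add_nonneg (hg0 v) h1) hle)
    obtain ⟨w', hw', e2⟩ := hB hw (max_le (hg0 b) (by linarith [hgb w])) (le_max_right 0 _)
    refine hdisj hv' hw' (or_iff_not_imp_left.2 fun hne => hball e1 e2 hne)
  have : Nonempty {v // ReachableAvoiding H S a v} := ⟨⟨a, .refl⟩⟩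
  obtain ⟨⟨v₀, hv₀⟩, hmax⟩ := Finite.exists_max fun v : {v // ReachableAvoiding H S a v} =>
    g v + max 0 (1 / 2 - k v)
  set α := g v₀ + max 0 (1 / 2 - k v₀)
  have hα0 : 0 ≤ α := add_nonneg (hg0 v₀) (le_max_left _ _)
  -- As there are finitely many vertices, `t` can be so close to `α` that no interval starts in
  -- between.
  obtain ⟨t, htα, ht⟩ : ∃ t, α < t ∧ ∀ x, α < g x - max 0 (1 / 2 - k x) →
      t < g x - max 0 (1 / 2 - k x) := by
    have h1 : ∀ᶠ t in nhdsWithin α (Set.Ioi α), ∀ x, α < g x - max 0 (1 / 2 - k x) →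
        t < g x - max 0 (1 / 2 - k x) := by
      rw [Filter.eventually_all]
      intro x
      by_cases hx : α < g x - max 0 (1 / 2 - k x)
      · filter_upwards [Ioo_mem_nhdsGT hx] with t ht _ using ht.2
      · exact Filter.Eventually.of_forall fun t e => absurd e hx
    obtain ⟨t, h2, h3⟩ := (h1.and self_mem_nhdsWithin).exists
    exact ⟨t, h3, h2⟩
  have : Nonempty V := ⟨u⟩
  refine (hm.attach b (t := t) (r := 1 / 2) (by linarith) (by norm_num) fun x => ?_).isLeafPower
  have hcov : t + 1 / 2 + m x x - 2 * min t (m b x) ≤ 1 ↔ k x + |t - g x| ≤ 1 / 2 := by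
    rcases le_total t (g x) with e | e
    · rw [abs_of_nonpos (by linarith), min_eq_left e]
      simp only [hg, hk]
      constructor <;> intro _ <;> linarith
    · rw [abs_of_nonneg (by linarith), min_eq_right e]
      simp only [hg, hk]
      constructor <;> intro _ <;> linarith
  rw [hcov]
  change x ∈ S ↔ _
  constructor
  · intro hx
    obtain ⟨v, hv, hvx⟩ := exists_adj_of_minimal_separates hS hx
    obtain ⟨w, hw, hwx⟩ := exists_adj_of_minimal_separates (minimal_separates_symm hS) hx
    have h1 := (hends v x hvx).trans (hmax ⟨v, hv⟩)
    have h2 := hends x w hwx.symm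
    have h3 := ht w (hlt hv₀ hw)
    rcases max_cases 0 (1 / 2 - k x) with ⟨h4, -⟩ | ⟨h4, -⟩
    · rw [h4] at h1 h2
      linarith
    · rw [h4] at h1 h2
      have : |t - g x| ≤ 1 / 2 - k x := abs_le.2 ⟨by linarith, by linarith⟩
      linarith
  · intro hx
    by_contra hxS
    have h1 : k x ≤ 1 / 2 := by linarith [abs_nonneg (t - g x)]
    have h2 : max 0 (1 / 2 - k x) = 1 / 2 - k x := max_eq_right (by linarith)
    obtain ⟨h3, h4⟩ := abs_le.1 (show |t - g x| ≤ 1 / 2 - k x by linarith)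
    have hxA : ¬ ReachableAvoiding H S a x := by
      intro e
      have := hmax ⟨x, e⟩
      simp only [h2] at this
      linarith
    rcases lt_or_ge α (g x - max 0 (1 / 2 - k x)) with e | e
    · have := ht x e
      linarith
    -- Here the ball around `x` also covers `α`, as does one from the component of `a`; so `x` would
    -- belong to that component, whose intervals end by `α < t`.
    · obtain ⟨v, hv, h5⟩ := hA hv₀ hα0 le_rfl
      have h6 : k x + |α - g x| ≤ 1 / 2 := by
        have : |α - g x| ≤ 1 / 2 - k x := abs_le.2 ⟨by linarith, by linarith⟩
        linarith
      have hne : v ≠ x := by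
        rintro rfl
        exact hxA hv
      exact hxA (Relation.ReflTransGen.tail hv
        ⟨hball h5 h6 hne, ReachableAvoiding.notMem hS.1.1 hv, hxS⟩)

end LeafPower

theorem mainTheorem4 {V : Type*} [Fintype V] [Nontrivial V] (G : SimpleGraph V)
    [DecidableRel G.Adj] (u : V)
    (hu : G.IsUniversal u ∨
      G.degree u = 1 ∨
      LeafPower.IsMinimalSeparator (LeafPower.deleteVertex G u) (LeafPower.nbhd G u) ∨
      Maximal (LeafPower.deleteVertex G u).IsClique (LeafPower.nbhd G u)) :
    LeafPower.IsLeafPower G ↔ LeafPower.IsLeafPower (LeafPower.deleteVertex G u) := by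
  refine ⟨fun h => h.deleteVertex u, fun h => ?_⟩
  rcases hu with hu | hu | hu | hu
  · exact LeafPower.isLeafPower_of_isUniversal hu h
  · exact LeafPower.isLeafPower_of_existsUnique_adj
      (SimpleGraph.degree_eq_one_iff_existsUnique_adj.1 hu) h
  · exact LeafPower.isLeafPower_of_isMinimalSeparator hu h
  · exact LeafPower.isLeafPower_of_maximal_isClique hu h
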